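/- Let $M=(E,r)$ be a matroid on a finite nonempty ground set $E$, with rank function $r$ and $r(M)=r(E)$. Let $$P(M)=\Bigl\{v\in\mathbb R^E : v\ge 0,\ \sum_{e\in U}v_e\le r(U)\text{ for all }U\subseteq E,\ \sum_{e\in E}v_e=r(E)\Bigr\}$$ be its base polytope, let $\Delta\subset\mathbb R^E$ be the standard simplex (the convex hull of the unit vectors $\mathbf e_i$, $i\in E$), and let $\nabla=-\Delta$. For integers $t,u\ge 0$ let $$Q_M(t,u)=\#\bigl((P(M)+u\Delta+t\nabla)\cap\mathbb Z^E\bigr).$$ Then there is a unique family of rational numbers $(c_{ij})_{i,j\ge 0}$ with finitely many nonzero terms such that $Q_M(t,u)=\sum_{i,j}c_{ij}\binom uj\binom ti$ for all integers $t,u\ge0$. Put $Q'_M(x,y)=\sum_{i,j}c_{ij}(x-1)^i(y-1)^j$, and let $$T_M(x,y)=\sum_{S\subseteq E}(x-1)^{r(M)-r(S)}(y-1)^{|S|-r(S)}$$ be the Tutte polynomial of $M$. Then, in the field $\mathbb Q(x,y)$ of rational functions, $$Q'_M(x,y)=\frac{x^{|E|-r(M)}\,y^{r(M)}}{x+y-1}\cdot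 T_M\!\left(\frac{x+y-1}{y},\frac{x+y-1}{x}\right).$$ -/

import Mathlib

open scoped Pointwise

/-- The rank function of a matroid `M`, `S ↦ r(S)`, on the finite subsets `S` of its ground set. -/
noncomputable def Matroid.rankFun {α : Type*} (M : Matroid α) (S : Finset M.E) : ℕ :=
  (M.eRk ((fun e : M.E => (e : α)) '' (S : Set M.E))).toNat

namespace RankFunction

variable {E : Type*} [Fintype E]

/-- The extended polymatroid of a rank function `r` on the finite set `E`: the set of all
`x ∈ ℝ^E` with `x ≥ 0` and `∑_{e ∈ U} x_e ≤ r(U)` for all `U ⊆ E`. -/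
def extendedPolymatroid (r : Finset E → ℕ) : Set (E → ℝ) :=
  {x | (∀ e, 0 ≤ x e) ∧ ∀ U : Finset E, ∑ e ∈ U, x e ≤ (r U : ℝ)}

/-- The base polytope `P`: the points of the extended polymatroid whose coordinates sum
to `r(E)`. -/
def basePolytope (r : Finset E → ℕ) : Set (E → ℝ) :=
  extendedPolymatroid r ∩ {x | ∑ e, x e = (r Finset.univ : ℝ)}

/-- The Minkowski sum `P + uΔ + t∇`, where `Δ` is the standard simplex of `ℝ^E`
(the convex hull of the unit vectors) and `∇ = -Δ`. -/
def minkowskiSum (r : Finset E → ℕ) (t u : ℕ) : Set (E → ℝ) :=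
  basePolytope r + (u : ℝ) • stdSimplex ℝ E + (t : ℝ) • (-stdSimplex ℝ E)

/-- `Q(t,u)`, the number of lattice points of `P + uΔ + t∇`. -/
noncomputable def latticeCount (r : Finset E → ℕ) (t u : ℕ) : ℕ :=
  {z : E → ℤ | (fun e => (z e : ℝ)) ∈ minkowskiSum r t u}.ncard

/-- The finite family `c = (c_{ij})` is a family of coefficients of `Q` in the binomial basis:
`Q(t,u) = ∑_{i,j} c_{ij} (u choose j) (t choose i)` for all integers `t, u ≥ 0`. -/
def IsBinomialExpansion (r : Finset E → ℕ) (c : ℕ × ℕ →₀ ℚ) : Prop :=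
  ∀ t u : ℕ, (latticeCount r t u : ℚ) =
    c.sum fun ij a => a * (u.choose ij.2 : ℚ) * (t.choose ij.1 : ℚ)

open Classical in
/-- The coefficients `c_{ij}` of `Q` in the binomial basis (`0` if there is no such expansion). -/
noncomputable def binomialCoeffs (r : Finset E → ℕ) : ℕ × ℕ →₀ ℚ :=
  if h : ∃ c, IsBinomialExpansion r c then h.choose else 0

/-- The polynomial `Q'(x,y) = ∑_{i,j} c_{ij} (x-1)^i (y-1)^j`, with `x = X 0` and `y = X 1`. -/
noncomputable def qPrime (r : Finset E → ℕ) : MvPolynomial (Fin 2) ℚ :=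
  (binomialCoeffs r).sum fun ij a =>
    MvPolynomial.C a * (MvPolynomial.X 0 - 1) ^ ij.1 * (MvPolynomial.X 1 - 1) ^ ij.2

/-- The Tutte polynomial `T(x,y) = ∑_{S ⊆ E} (x-1)^{r(E)-r(S)} (y-1)^{|S|-r(S)}`, with `x = X 0`
and `y = X 1`. (For the rank function of a matroid, the exponents are nonnegative, so the natural
number subtractions are not truncated.) -/
noncomputable def tuttePolynomial (r : Finset E → ℕ) : MvPolynomial (Fin 2) ℚ :=
  ∑ S : Finset E,
    (MvPolynomial.X 0 - 1) ^ (r Finset.univ - r S) * (MvPolynomial.X 1 - 1) ^ (S.card - r S)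

end RankFunction

/-- The field `ℚ(x,y)` of rational functions in two variables. -/
abbrev RatFun2 : Type := FractionRing (MvPolynomial (Fin 2) ℚ)

/-- The variable `x` of `ℚ(x,y)`. -/
noncomputable def RatFun2.x : RatFun2 := algebraMap (MvPolynomial (Fin 2) ℚ) RatFun2 (MvPolynomial.X 0)

/-- The variable `y` of `ℚ(x,y)`. -/
noncomputable def RatFun2.y : RatFun2 := algebraMap (MvPolynomial (Fin 2) ℚ) RatFun2 (MvPolynomial.X 1)

/-! An integer point z with positive support S lies in P + uΔ + t∇ iff Σz = r(E) + u − t and Σ_S z ≤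
r(S) + u (`intCast_mem_minkowskiSum_iff`). Stack these slices: `region` is the disjoint union of
those for (s, u) with s ≤ t and (t, s) with s < u (`sum_ncard_slice`). It also splits over S into
products of two lattice simplices, so its size is a sum of products of binomials (`ncard_region`).

The functional `umbral t u` turns multiplication by x − 1 or y − 1 into summation over s < t or s <
u. Stacking therefore amounts to multiplication by 1 + (x − 1) + (y − 1) = x + y − 1, while the
binomial sum is the image of F = Σ_S `tutteTerm`, the rescaled Tutte polynomial. F is divisible by x
+ y − 1 (`exists_mul_eq_sum_tutteTerm`), and the quotient is Q' by induction on t + u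
(`umbral_eq_latticeCount`). -/

/-- Every set of elements meets some basis in a set of full rank: the form in which the matroid
axioms enter the count of lattice points. -/
def RankFunction.HasAdaptedBases {E : Type*} [Fintype E] [DecidableEq E]
    (r : Finset E → ℕ) : Prop :=
  ∀ S : Finset E, ∃ B : Finset E, B.card = r Finset.univ ∧ (B ∩ S).card = r S ∧
    ∀ U : Finset E, (B ∩ U).card ≤ r U

/-- Extend a basis I of S to a base B: then B ∩ S is independent and contains I, so it equals I by
maximality. -/
theorem Matroid.rankFun_hasAdaptedBases {α : Type*} (M : Matroid α) [Fintype M.E]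
    [DecidableEq M.E] : RankFunction.HasAdaptedBases M.rankFun := by
  intro S
  have hfin : M.E.Finite := Set.toFinite _
  set ι : M.E → α := fun e => (e : α) with hι
  have hinj : Function.Injective ι := Subtype.val_injective
  have hX : ι '' (S : Set M.E) ⊆ M.E := by
    rintro _ ⟨e, -, rfl⟩
    exact e.2
  obtain ⟨I, hI⟩ := M.exists_isBasis (ι '' (S : Set M.E)) hX
  obtain ⟨B, hB, hIB⟩ := hI.indep.exists_isBase_superset
  have hBI : B ∩ ι '' (S : Set M.E) = I := (hI.eq_of_subset_indep
    (hB.indep.subset Set.inter_subset_left) (Set.subset_inter hIB hI.subset)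
    Set.inter_subset_right).symm
  classical
  let B' : Finset M.E := Finset.univ.filter fun e => ι e ∈ B
  have himg : ∀ U : Finset M.E, ι '' ((B' ∩ U : Finset M.E) : Set M.E) = B ∩ ι '' (U : Set M.E) := by
    intro U
    ext a
    simp only [B', Set.mem_image, Finset.coe_inter, Finset.coe_filter, Finset.mem_univ, true_and,
      Set.mem_inter_iff, Set.mem_ofPred_eq, Finset.mem_coe]
    constructor
    · rintro ⟨e, ⟨h1, h2⟩, rfl⟩
      exact ⟨h1, e, h2, rfl⟩
    · rintro ⟨h1, e, h2, rfl⟩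
      exact ⟨e, ⟨h1, h2⟩, rfl⟩
  have hcard : ∀ U : Finset M.E,
      ((B' ∩ U).card : ℕ∞) = (B ∩ ι '' (U : Set M.E)).encard := by
    intro U
    rw [← himg, hinj.encard_image, Set.encard_coe_eq_coe_finsetCard]
  have hrk : ∀ U : Finset M.E, (M.rankFun U : ℕ∞) = M.eRk (ι '' (U : Set M.E)) := by
    intro U
    refine ENat.natCast_toNat (ne_of_lt ?_)
    refine (M.eRk_le_encard _).trans_lt ?_
    rw [Set.encard_lt_top_iff]
    exact (Set.toFinite _)
  have huniv : ι '' ((Finset.univ : Finset M.E) : Set M.E) = M.E := by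
    simp [hι]
  refine ⟨B', ?_, ?_, fun U => ?_⟩
  · have h := hcard Finset.univ
    have h2 := hrk Finset.univ
    rw [huniv] at h h2
    rw [Finset.inter_univ, Set.inter_eq_left.2 hB.subset_ground, hB.encard_eq_eRank,
      ← M.eRk_ground, ← h2] at h
    exact_mod_cast h
  · have h := hcard S
    rw [hBI, hI.encard_eq_eRk, ← hrk] at h
    exact_mod_cast h
  · have h : ((B' ∩ U).card : ℕ∞) ≤ M.rankFun U := by
      rw [hcard, hrk]
      exact (hB.indep.subset Set.inter_subset_left).encard_le_eRk_of_subset Set.inter_subset_right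
    exact_mod_cast h

/-! ### Lattice points of the Minkowski sum -/

namespace RankFunction

variable {E : Type*} [Fintype E] {r : Finset E → ℕ}

/-- The set of coordinates at which an integer vector is positive. -/
def posSet (z : E → ℤ) : Finset E := Finset.univ.filter fun e => 0 < z e

theorem mem_posSet {z : E → ℤ} {e : E} : e ∈ posSet z ↔ 0 < z e := by
  simp [posSet]

variable [DecidableEq E]

theorem HasAdaptedBases.le_card (hr : HasAdaptedBases r) (S : Finset E) : r S ≤ S.card := by
  obtain ⟨B, -, h, -⟩ := hr S
  exact h ▸ Finset.card_le_card Finset.inter_subset_right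

theorem HasAdaptedBases.le_univ (hr : HasAdaptedBases r) (S : Finset E) :
    r S ≤ r Finset.univ := by
  obtain ⟨B, h₁, h, -⟩ := hr S
  exact h ▸ h₁ ▸ Finset.card_le_card Finset.inter_subset_left

theorem HasAdaptedBases.univ_sub_le (hr : HasAdaptedBases r) (S : Finset E) :
    r Finset.univ - r S ≤ Sᶜ.card := by
  obtain ⟨B, h₁, h, -⟩ := hr S
  have h2 : (B \ S).card ≤ Sᶜ.card := by
    refine Finset.card_le_card fun e he => ?_
    simp only [Finset.mem_sdiff, Finset.mem_compl] at he ⊢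
    exact he.2
  have := Finset.card_inter_add_card_sdiff B S
  omega

/-- The lattice points of `P + uΔ + t∇`, described by a single rank inequality. -/
def slice (r : Finset E → ℕ) (t u : ℕ) : Set (E → ℤ) :=
  {z | ∑ e, z e + t = r Finset.univ + u ∧ ∑ e ∈ posSet z, z e ≤ r (posSet z) + u}

theorem mem_smul_stdSimplex_iff [Nonempty E] {n : ℕ} {a : E → ℝ} :
    a ∈ (n : ℝ) • stdSimplex ℝ E ↔ (∀ e, 0 ≤ a e) ∧ ∑ e, a e = n := by
  constructor
  · rintro ⟨b, ⟨h0, h1⟩, rfl⟩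
    refine ⟨fun e => mul_nonneg (Nat.cast_nonneg n) (h0 e), ?_⟩
    simp only [Pi.smul_apply, smul_eq_mul, ← Finset.mul_sum, h1, mul_one]
  · rintro ⟨h0, h1⟩
    -- For n = 0 the dilate is {0} only because the simplex is nonempty; this needs a point of E.
    rcases eq_or_ne n 0 with rfl | hn
    · have ha : a = 0 := by
        ext e
        exact (Finset.sum_eq_zero_iff_of_nonneg fun e _ => h0 e).1 (by simpa using h1) e
          (Finset.mem_univ e)
      obtain ⟨e⟩ := ‹Nonempty E›
      exact ⟨Pi.single e 1, single_mem_stdSimplex ℝ e, by simp [ha]⟩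
    · have hn' : (n : ℝ) ≠ 0 := by exact_mod_cast hn
      refine ⟨(n : ℝ)⁻¹ • a, ⟨fun e => ?_, ?_⟩, smul_inv_smul₀ hn' a⟩
      · exact mul_nonneg (by positivity) (h0 e)
      · simp only [Pi.smul_apply, smul_eq_mul, ← Finset.mul_sum, h1]
        exact inv_mul_cancel₀ hn'

theorem mem_minkowskiSum_iff [Nonempty E] {t u : ℕ} {x : E → ℝ} : x ∈ minkowskiSum r t u ↔
    ∃ p ∈ basePolytope r, ∃ a b : E → ℝ, ((∀ e, 0 ≤ a e) ∧ ∑ e, a e = u) ∧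
      ((∀ e, 0 ≤ b e) ∧ ∑ e, b e = t) ∧ x = p + a - b := by
  have hneg : ∀ b : E → ℝ, b ∈ (t : ℝ) • (-stdSimplex ℝ E) ↔ -b ∈ (t : ℝ) • stdSimplex ℝ E := by
    intro b
    rw [Set.smul_set_neg, Set.mem_neg]
  simp only [minkowskiSum, Set.mem_add, hneg, ← mem_smul_stdSimplex_iff]
  constructor
  · rintro ⟨_, ⟨p, hp, a, ha, rfl⟩, b, hb, rfl⟩
    exact ⟨p, hp, a, -b, ha, hb, by simp⟩
  · rintro ⟨p, hp, a, b, ha, hb, rfl⟩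
    exact ⟨_, ⟨p, hp, a, ha, rfl⟩, -b, by simpa using hb, by simp [sub_eq_add_neg]⟩

/-- Only the rank inequality on the positive support matters: for a base B adapted to it, the
positive part of z − χ_B has total at most u, and the rest of z is reached by subtraction. -/
theorem intCast_mem_minkowskiSum_iff [Nonempty E] (hr : HasAdaptedBases r) {t u : ℕ}
    {z : E → ℤ} : (fun e => (z e : ℝ)) ∈ minkowskiSum r t u ↔ z ∈ slice r t u := by
  rw [mem_minkowskiSum_iff]
  constructor
  · rintro ⟨p, ⟨⟨-, hp⟩, hpE⟩, a, b, ⟨ha, hau⟩, ⟨hb, hbt⟩, hz⟩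
    have hz' : ∀ e, (z e : ℝ) = p e + a e - b e := fun e => congrFun hz e
    have hpE' : ∑ e, p e = r Finset.univ := hpE
    refine ⟨?_, ?_⟩
    · have : ((∑ e, z e : ℤ) : ℝ) + t = r Finset.univ + u := by
        push_cast
        simp only [hz', Finset.sum_add_distrib, Finset.sum_sub_distrib, hpE', hau, hbt]
        ring
      exact_mod_cast this
    · have h1 := hp (posSet z)
      have h2 : ∑ e ∈ posSet z, a e ≤ u :=
        hau ▸ Finset.sum_le_sum_of_subset_of_nonneg (Finset.subset_univ _) fun e _ _ => ha e
      have h3 : 0 ≤ ∑ e ∈ posSet z, b e := Finset.sum_nonneg fun e _ => hb e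
      have : ((∑ e ∈ posSet z, z e : ℤ) : ℝ) ≤ r (posSet z) + u := by
        push_cast
        simp only [hz', Finset.sum_add_distrib, Finset.sum_sub_distrib]
        linarith
      exact_mod_cast this
  · rintro ⟨hsum, hle⟩
    obtain ⟨B, hB, hBS, hBU⟩ := hr (posSet z)
    set χ : E → ℤ := fun e => if e ∈ B then 1 else 0 with hχ
    have hχU : ∀ U : Finset E, ∑ e ∈ U, χ e = ((B ∩ U).card : ℤ) := by
      intro U
      rw [Finset.inter_comm, hχ, Finset.sum_boole, Finset.filter_mem_eq_inter]
    set A : E → ℤ := fun e => max (z e - χ e) 0 with hA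
    have hAsum : ∑ e, A e = ∑ e ∈ posSet z, z e - r (posSet z) := by
      -- Integrality: a positive entry is at least 1, hence at least χ e.
      have h1 : ∀ e, A e = if e ∈ posSet z then z e - χ e else 0 := by
        intro e
        simp only [hA, hχ, posSet, Finset.mem_filter, Finset.mem_univ, true_and]
        split_ifs <;> omega
      rw [Finset.sum_congr rfl fun e _ => h1 e, Finset.sum_ite_mem, Finset.univ_inter,
        Finset.sum_sub_distrib, hχU, hBS]
    obtain ⟨i⟩ := ‹Nonempty E›
    -- The unused part of u is added at an arbitrary coordinate and subtracted again through t∇.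
    set d : ℤ := u - ∑ e, A e with hd
    have hd0 : 0 ≤ d := by omega
    set A' : E → ℤ := A + Pi.single i d with hA'
    have hS : ∑ e, A' e = u := by
      simp [hA', Finset.sum_add_distrib, hd]
    have hnn : ∀ e, 0 ≤ (Pi.single i d : E → ℤ) e := fun e =>
      (Pi.single_nonneg.2 hd0 : (0 : E → ℤ) ≤ Pi.single i d) e
    refine ⟨fun e => χ e, ⟨⟨fun e => ?_, fun U => ?_⟩, ?_⟩, fun e => A' e,
      fun e => (χ e + A' e - z e : ℤ), ⟨fun e => ?_, ?_⟩, ⟨fun e => ?_, ?_⟩, ?_⟩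
    · simp only [hχ]; split_ifs <;> simp
    · have := hBU U
      have h2 := hχU U
      have : (∑ e ∈ U, χ e) ≤ (r U : ℤ) := by omega
      beta_reduce; exact_mod_cast this
    · have h2 := hχU Finset.univ
      rw [Finset.inter_univ, hB] at h2
      show ∑ e, (χ e : ℝ) = _
      exact_mod_cast h2
    · have := hnn e
      have : 0 ≤ A' e := by simp only [hA', Pi.add_apply, hA]; omega
      beta_reduce; exact_mod_cast this
    · beta_reduce; exact_mod_cast hS
    · have := hnn e
      have : 0 ≤ χ e + A' e - z e := by simp only [hA', Pi.add_apply, hA]; omega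
      beta_reduce; exact_mod_cast this
    · have h2 := hχU Finset.univ
      rw [Finset.inter_univ, hB] at h2
      have : ∑ e, (χ e + A' e - z e) = t := by
        rw [Finset.sum_sub_distrib, Finset.sum_add_distrib, h2, hS]
        omega
      beta_reduce; exact_mod_cast this
    · ext e
      simp

theorem latticeCount_eq_ncard_slice [Nonempty E] (hr : HasAdaptedBases r) (t u : ℕ) :
    latticeCount r t u = (slice r t u).ncard := by
  simp only [latticeCount, intCast_mem_minkowskiSum_iff hr]
  rfl

end RankFunction

/-! ### Counting the stacked region -/

namespace RankFunction

/-- Stars and bars, with `none` as the slack coordinate. -/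
theorem finite_and_ncard_sum_le (T : Type*) [Fintype T] (n : ℕ) :
    {v : T → ℕ | ∑ e, v e ≤ n}.Finite ∧
      {v : T → ℕ | ∑ e, v e ≤ n}.ncard = (n + Fintype.card T).choose (Fintype.card T) := by
  classical
  let φ : {v : T → ℕ // ∑ e, v e ≤ n} ≃ {w : Option T → ℕ // ∑ e, w e = n} :=
    { toFun := fun v => ⟨fun o => o.elim (n - ∑ e, v.1 e) v.1, by
        have := v.2
        simpa [Fintype.sum_option] using Nat.sub_add_cancel this⟩
      invFun := fun w => ⟨fun e => w.1 (some e), by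
        have := w.2
        rw [Fintype.sum_option] at this
        change ∑ e, w.1 (some e) ≤ n
        omega⟩
      left_inv := fun v => rfl
      right_inv := fun w => by
        have := w.2
        rw [Fintype.sum_option] at this
        ext o
        cases o with
        | none => simp; omega
        | some e => rfl }
  let ψ := φ.trans (Sym.equivNatSumOfFintype (Option T) n).symm
  have : Finite {v : T → ℕ | ∑ e, v e ≤ n} := Finite.of_equiv _ ψ.symm
  refine ⟨Set.toFinite _, ?_⟩
  change Nat.card {v : T → ℕ // ∑ e, v e ≤ n} = _
  rw [Nat.card_congr ψ, Nat.card_eq_fintype_card, Sym.card_sym_eq_choose, Fintype.card_option,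
    show Fintype.card T + 1 + n - 1 = n + Fintype.card T by omega]
  exact Nat.choose_symm_add

variable {E : Type*} [DecidableEq E]

/-- The integer vector with positive entries `v e + 1` on `S` and nonpositive entries `-v e`
elsewhere. -/
def signed (S : Finset E) (v : E → ℕ) : E → ℤ := fun e => if e ∈ S then v e + 1 else -v e

theorem signed_injective (S : Finset E) : Function.Injective (signed S) := by
  intro v w h
  ext e
  have := congrFun h e
  simp only [signed] at this
  split_ifs at this <;> omega

theorem sum_signed (S : Finset E) (v : E → ℕ) :
    ∑ e ∈ S, signed S v e = ∑ e ∈ S, v e + S.card := by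
  rw [Finset.sum_congr rfl (g := fun e => (v e : ℤ) + 1) fun e he => by simp [signed, he]]
  simp [Finset.sum_add_distrib]

variable [Fintype E] {r : Finset E → ℕ}

theorem finite_and_ncard_sum_le_and_sum_compl_le (S : Finset E) (a b : ℕ) :
    {v : E → ℕ | ∑ e ∈ S, v e ≤ a ∧ ∑ e ∈ Sᶜ, v e ≤ b}.Finite ∧
      {v : E → ℕ | ∑ e ∈ S, v e ≤ a ∧ ∑ e ∈ Sᶜ, v e ≤ b}.ncard =
        (a + S.card).choose S.card * (b + Sᶜ.card).choose Sᶜ.card := by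
  obtain ⟨hf₁, hc₁⟩ := finite_and_ncard_sum_le {e // e ∈ S} a
  obtain ⟨hf₂, hc₂⟩ := finite_and_ncard_sum_le {e // e ∉ S} b
  have hcard : Fintype.card {e // e ∉ S} = Sᶜ.card := by
    rw [Fintype.card_subtype]; congr 1; ext; simp
  have hpre : {v : E → ℕ | ∑ e ∈ S, v e ≤ a ∧ ∑ e ∈ Sᶜ, v e ≤ b} =
      (Equiv.piEquivPiSubtypeProd (· ∈ S) fun _ => ℕ).symm ''
        ({v | ∑ e, v e ≤ a} ×ˢ {v | ∑ e, v e ≤ b}) := by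
    rw [Equiv.image_symm_eq_preimage]
    ext v
    have h₁ : ∑ e : {e // e ∈ S}, v e = ∑ e ∈ S, v e := Finset.sum_coe_sort S v
    have h₂ : ∑ e : {e // e ∉ S}, v e = ∑ e ∈ Sᶜ, v e :=
      (Finset.sum_subtype Sᶜ (fun e => Finset.mem_compl) v).symm
    simp only [Set.mem_ofPred_eq, Set.mem_preimage, Set.mem_prod,
      Equiv.piEquivPiSubtypeProd_apply, h₁, h₂]
  rw [hpre]
  refine ⟨(hf₁.prod hf₂).image _, ?_⟩
  rw [Set.ncard_image_of_injective _ (Equiv.injective _), Set.ncard_prod, hc₁, hc₂, hcard,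
    Fintype.card_coe]

/-- The lattice points within distance `u` above and `t` below `P`, over all coordinate sums. -/
def region (r : Finset E → ℕ) (t u : ℕ) : Set (E → ℤ) :=
  {z | ∑ e ∈ posSet z, z e ≤ r (posSet z) + u ∧
    ∑ e ∈ posSet z, z e + r Finset.univ ≤ ∑ e, z e + t + r (posSet z)}

theorem posSet_signed (S : Finset E) (v : E → ℕ) : posSet (signed S v) = S := by
  ext e
  by_cases h : e ∈ S
  · simp only [mem_posSet, signed, h, if_true, iff_true]
    omega
  · simp [mem_posSet, signed, h]

theorem exists_signed_eq (z : E → ℤ) : ∃ v, signed (posSet z) v = z := by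
  refine ⟨fun e => if e ∈ posSet z then (z e - 1).toNat else (-z e).toNat, ?_⟩
  ext e
  by_cases h : 0 < z e
  · simp [signed, posSet, h]
  · simp [signed, posSet, h]; omega

theorem sum_compl_signed (S : Finset E) (v : E → ℕ) :
    ∑ e ∈ Sᶜ, signed S v e = -∑ e ∈ Sᶜ, (v e : ℤ) := by
  rw [Finset.sum_congr rfl (g := fun e => -(v e : ℤ)) fun e he => by
    simp [signed, Finset.mem_compl.1 he]]
  simp

/-- With the positive support fixed, the two inequalities decouple: one involves only S, the other
only its complement. -/
theorem region_fiber_eq (r : Finset E → ℕ) (t u : ℕ) (S : Finset E) :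
    {z ∈ region r t u | posSet z = S} = signed S ''
      {v | ∑ e ∈ S, v e + S.card ≤ r S + u ∧ ∑ e ∈ Sᶜ, v e + r Finset.univ ≤ t + r S} := by
  have key : ∀ v, signed S v ∈ region r t u ↔
      ∑ e ∈ S, v e + S.card ≤ r S + u ∧ ∑ e ∈ Sᶜ, v e + r Finset.univ ≤ t + r S := by
    intro v
    have h₁ := sum_signed S v
    have h₂ := sum_compl_signed S v
    have h₃ := Finset.sum_add_sum_compl S (signed S v)
    simp only [region, Set.mem_ofPred_eq, posSet_signed]
    zify
    rw [Nat.cast_sum] at h₁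
    constructor <;> rintro ⟨h, h'⟩ <;> constructor <;> linarith
  ext z
  constructor
  · rintro ⟨hz, rfl⟩
    obtain ⟨v, hv⟩ := exists_signed_eq z
    exact ⟨v, (key v).1 (hv.symm ▸ hz), hv⟩
  · rintro ⟨v, hv, rfl⟩
    exact ⟨(key v).2 hv, posSet_signed S v⟩

theorem region_fiber_finite_and_ncard (hr : HasAdaptedBases r) (t u : ℕ) (S : Finset E) :
    {z ∈ region r t u | posSet z = S}.Finite ∧ {z ∈ region r t u | posSet z = S}.ncard =
      (t + (Sᶜ.card - (r Finset.univ - r S))).choose Sᶜ.card * (u + r S).choose S.card := by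
  have h₁ := hr.le_univ S
  have h₂ := hr.univ_sub_le S
  have h₃ := hr.le_card S
  rw [region_fiber_eq, Set.ncard_image_of_injective _ (signed_injective S)]
  by_cases h : S.card ≤ r S + u ∧ r Finset.univ - r S ≤ t
  · obtain ⟨hf, hc⟩ := finite_and_ncard_sum_le_and_sum_compl_le S (r S + u - S.card)
      (t - (r Finset.univ - r S))
    have hset : {v : E → ℕ | ∑ e ∈ S, v e + S.card ≤ r S + u ∧
        ∑ e ∈ Sᶜ, v e + r Finset.univ ≤ t + r S} = {v | ∑ e ∈ S, v e ≤ r S + u - S.card ∧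
        ∑ e ∈ Sᶜ, v e ≤ t - (r Finset.univ - r S)} := by
      ext v
      simp only [Set.mem_ofPred_eq]
      omega
    rw [hset]
    refine ⟨hf.image _, ?_⟩
    rw [hc, mul_comm]
    congr 2 <;> omega
  -- A simplex of negative size: the fiber is empty, and the corresponding binomial vanishes.
  · have hset : {v : E → ℕ | ∑ e ∈ S, v e + S.card ≤ r S + u ∧
        ∑ e ∈ Sᶜ, v e + r Finset.univ ≤ t + r S} = ∅ := by
      refine Set.eq_empty_iff_forall_notMem.2 fun v hv => h ?_
      have := hv.1
      have := hv.2
      omega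
    rw [hset]
    refine ⟨by simp, ?_⟩
    rw [Set.ncard_empty, eq_comm, mul_eq_zero]
    by_cases h' : S.card ≤ r S + u
    · exact Or.inl (Nat.choose_eq_zero_of_lt (by omega))
    · exact Or.inr (Nat.choose_eq_zero_of_lt (by omega))

theorem region_finite (hr : HasAdaptedBases r) (t u : ℕ) : (region r t u).Finite := by
  refine (Set.finite_iUnion fun S => (region_fiber_finite_and_ncard hr t u S).1).subset
    fun z hz => Set.mem_iUnion.2 ⟨posSet z, hz, rfl⟩

theorem ncard_eq_sum_ncard_fiber {X ι : Type*} [DecidableEq ι] {A : Set X} (hA : A.Finite)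
    (f : X → ι) (s : Finset ι) (hf : ∀ x ∈ A, f x ∈ s) :
    A.ncard = ∑ i ∈ s, {x ∈ A | f x = i}.ncard := by
  classical
  rw [Set.ncard_eq_toFinset_card A hA, Finset.card_eq_sum_card_fiberwise (f := f) (t := s)
    fun x hx => hf x (by simpa using hx)]
  refine Finset.sum_congr rfl fun i _ => ?_
  rw [← Set.ncard_coe_finset]
  congr 1
  ext x
  simp

theorem ncard_region (hr : HasAdaptedBases r) (t u : ℕ) : (region r t u).ncard =
    ∑ S : Finset E, (t + (Sᶜ.card - (r Finset.univ - r S))).choose Sᶜ.card *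
      (u + r S).choose S.card := by
  rw [ncard_eq_sum_ncard_fiber (region_finite hr t u) posSet Finset.univ (by simp)]
  exact Finset.sum_congr rfl fun S _ => (region_fiber_finite_and_ncard hr t u S).2

theorem sum_posSet_nonneg (z : E → ℤ) : (posSet z).card ≤ ∑ e ∈ posSet z, z e := by
  obtain ⟨v, hv⟩ := exists_signed_eq z
  have h := sum_signed (posSet z) v
  rw [hv] at h
  have : 0 ≤ ∑ e ∈ posSet z, (v e : ℤ) := by positivity
  omega

theorem sum_le_sum_posSet (z : E → ℤ) : ∑ e, z e ≤ ∑ e ∈ posSet z, z e := by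
  obtain ⟨v, hv⟩ := exists_signed_eq z
  have h := sum_compl_signed (posSet z) v
  rw [hv] at h
  have h₃ := Finset.sum_add_sum_compl (posSet z) z
  have : 0 ≤ ∑ e ∈ (posSet z)ᶜ, (v e : ℤ) := by positivity
  omega

/-- Splitting `region r t u` by the coordinate sum. -/
theorem sum_ncard_slice (hr : HasAdaptedBases r) (t u : ℕ) :
    ∑ s ∈ Finset.range t, (slice r s u).ncard + ∑ s ∈ Finset.range u, (slice r t s).ncard +
      (slice r t u).ncard = (region r t u).ncard := by
  -- The level of z; `hlow` ensures that `toNat` truncates nothing on the region.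
  let f : (E → ℤ) → ℕ := fun z => (∑ e, z e + t - r Finset.univ).toNat
  have hlow : ∀ z ∈ region r t u, (r Finset.univ : ℤ) ≤ ∑ e, z e + t := by
    rintro z ⟨-, hz⟩
    have := hr.le_card (posSet z)
    have := sum_posSet_nonneg z
    omega
  -- Below level u the second inequality of `region` implies the first; from level u on, the first
  -- implies the second.
  have hbelow : ∀ s ∈ Finset.range u, {z ∈ region r t u | f z = s} = slice r t s := by
    intro s hs
    rw [Finset.mem_range] at hs
    ext z
    constructor
    · rintro ⟨hz, hzs⟩
      have h₁ := hlow z hz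
      have h₂ := hz.2
      simp only [f] at hzs
      constructor <;> omega
    · rintro ⟨h₁, h₂⟩
      refine ⟨⟨by omega, by omega⟩, ?_⟩
      simp only [f]
      omega
  have habove : ∀ s ∈ Finset.range (t + 1),
      {z ∈ region r t u | f z = u + s} = slice r (t - s) u := by
    intro s hs
    rw [Finset.mem_range] at hs
    ext z
    constructor
    · rintro ⟨hz, hzs⟩
      have h₁ := hlow z hz
      have h₂ := hz.1
      simp only [f] at hzs
      constructor <;> omega
    · rintro ⟨h₁, h₂⟩
      refine ⟨⟨by omega, by omega⟩, ?_⟩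
      simp only [f]
      omega
  have hreflect : ∑ s ∈ Finset.range t, (slice r s u).ncard =
      ∑ s ∈ Finset.range t, (slice r (t - (s + 1)) u).ncard := by
    rw [← Finset.sum_range_reflect]
    exact Finset.sum_congr rfl fun s _ => by rw [Nat.sub_sub, add_comm 1 s]
  rw [ncard_eq_sum_ncard_fiber (region_finite hr t u) f (Finset.range (u + (t + 1))) ?_,
    Finset.sum_range_add, Finset.sum_congr rfl fun s hs => congrArg Set.ncard (hbelow s hs),
    Finset.sum_congr (s₁ := Finset.range (t + 1)) rfl fun s hs =>
      congrArg Set.ncard (habove s hs),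
    Finset.sum_range_succ' (fun s => (slice r (t - s) u).ncard), Nat.sub_zero, hreflect]
  · ring
  · intro z hz
    have h₁ := hlow z hz
    have h₂ := hz.1
    have h₃ := hr.le_univ (posSet z)
    have h₄ := sum_le_sum_posSet z
    simp only [f, Finset.mem_range]
    omega

end RankFunction

/-! ### Umbral calculus for binomial expansions -/

namespace RankFunction

open MvPolynomial

/-- The value at `(t, u)` of the function with binomial coefficients `c`. -/
noncomputable def binomialEval (t u : ℕ) : (ℕ × ℕ →₀ ℚ) →ₗ[ℚ] ℚ :=
  Finsupp.linearCombination ℚ fun ij => (u.choose ij.2 : ℚ) * (t.choose ij.1 : ℚ)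

/-- The polynomial `∑ c_{ij} (x-1)^i (y-1)^j`. -/
noncomputable def shiftedPoly : (ℕ × ℕ →₀ ℚ) →ₗ[ℚ] MvPolynomial (Fin 2) ℚ :=
  Finsupp.linearCombination ℚ fun ij => (X 0 - 1) ^ ij.1 * (X 1 - 1) ^ ij.2

/-- The linear functional taking `(x-1)^i (y-1)^j` to `(u choose j) (t choose i)`. -/
noncomputable def umbral (t u : ℕ) : MvPolynomial (Fin 2) ℚ →ₗ[ℚ] ℚ :=
  (basisMonomials (Fin 2) ℚ).constr ℚ
      (fun m => (u.choose (m 1) : ℚ) * (t.choose (m 0) : ℚ)) ∘ₗ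
    (aeval ![X 0 + 1, X 1 + 1] :
      MvPolynomial (Fin 2) ℚ →ₐ[ℚ] MvPolynomial (Fin 2) ℚ).toLinearMap

theorem umbral_apply (t u i j : ℕ) :
    umbral t u ((X 0 - 1) ^ i * (X 1 - 1) ^ j) = (u.choose j : ℚ) * (t.choose i : ℚ) := by
  have h : (aeval ![X 0 + 1, X 1 + 1] :
      MvPolynomial (Fin 2) ℚ →ₐ[ℚ] MvPolynomial (Fin 2) ℚ) ((X 0 - 1) ^ i * (X 1 - 1) ^ j) =
      basisMonomials (Fin 2) ℚ (Finsupp.single 0 i + Finsupp.single 1 j) := by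
    simp [X_pow_eq_monomial, monomial_mul]
  rw [umbral, LinearMap.comp_apply, AlgHom.toLinearMap_apply, h, Module.Basis.constr_basis]
  simp

theorem umbral_shiftedPoly (t u : ℕ) (c : ℕ × ℕ →₀ ℚ) :
    umbral t u (shiftedPoly c) = binomialEval t u c := by
  refine LinearMap.congr_fun (f := umbral t u ∘ₗ shiftedPoly) (Finsupp.lhom_ext fun ij a => ?_) c
  simp [shiftedPoly, binomialEval, umbral_apply]

theorem shiftedPoly_mapDomain_left (c : ℕ × ℕ →₀ ℚ) :
    shiftedPoly (c.mapDomain fun ij => (ij.1 + 1, ij.2)) = (X 0 - 1) * shiftedPoly c := by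
  refine LinearMap.congr_fun (f := shiftedPoly ∘ₗ Finsupp.lmapDomain ℚ ℚ _)
    (g := LinearMap.mulLeft ℚ (X 0 - 1) ∘ₗ shiftedPoly) (Finsupp.lhom_ext fun ij a => ?_) c
  simp [shiftedPoly, Finsupp.mapDomain_single, pow_succ', mul_assoc]

theorem shiftedPoly_mapDomain_right (c : ℕ × ℕ →₀ ℚ) :
    shiftedPoly (c.mapDomain fun ij => (ij.1, ij.2 + 1)) = (X 1 - 1) * shiftedPoly c := by
  refine LinearMap.congr_fun (f := shiftedPoly ∘ₗ Finsupp.lmapDomain ℚ ℚ _)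
    (g := LinearMap.mulLeft ℚ (X 1 - 1) ∘ₗ shiftedPoly) (Finsupp.lhom_ext fun ij a => ?_) c
  simp [shiftedPoly, Finsupp.mapDomain_single, pow_succ', mul_left_comm]

theorem shiftedPoly_surjective : Function.Surjective shiftedPoly := by
  intro p
  induction p using MvPolynomial.induction_on with
  | C a => exact ⟨Finsupp.single (0, 0) a, by simp [shiftedPoly, smul_eq_C_mul]⟩
  | add p q hp hq =>
    obtain ⟨c, rfl⟩ := hp
    obtain ⟨d, rfl⟩ := hq
    exact ⟨c + d, map_add _ _ _⟩
  | mul_X p n hp =>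
    obtain ⟨c, rfl⟩ := hp
    fin_cases n
    · exact ⟨_ + c, (map_add _ _ _).trans ((congrArg (· + _) (shiftedPoly_mapDomain_left c)).trans
        (by simp only [Fin.zero_eta]; ring))⟩
    · exact ⟨_ + c, (map_add _ _ _).trans ((congrArg (· + _) (shiftedPoly_mapDomain_right c)).trans
        (by simp only [Fin.mk_one]; ring))⟩

theorem sum_range_choose_eq (n k : ℕ) :
    ∑ s ∈ Finset.range n, (s.choose k : ℚ) = n.choose (k + 1) := by
  induction n with
  | zero => simp
  | succ n ih => rw [Finset.sum_range_succ, ih, Nat.choose_succ_succ]; push_cast; ring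

/-- The hockey-stick identity: raising i by one sums C(s, i) over s < t. -/
theorem umbral_sub_one_mul_left (t u : ℕ) (p : MvPolynomial (Fin 2) ℚ) :
    umbral t u ((X 0 - 1) * p) = ∑ s ∈ Finset.range t, umbral s u p := by
  obtain ⟨c, rfl⟩ := shiftedPoly_surjective p
  rw [← shiftedPoly_mapDomain_left]
  simp only [umbral_shiftedPoly]
  refine (LinearMap.congr_fun (f := binomialEval t u ∘ₗ Finsupp.lmapDomain ℚ ℚ _)
    (g := ∑ s ∈ Finset.range t, binomialEval s u) (Finsupp.lhom_ext fun ij a => ?_) c).trans ?_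
  · simp [binomialEval, Finsupp.mapDomain_single, ← Finset.mul_sum, sum_range_choose_eq]
  · simp

theorem umbral_sub_one_mul_right (t u : ℕ) (p : MvPolynomial (Fin 2) ℚ) :
    umbral t u ((X 1 - 1) * p) = ∑ s ∈ Finset.range u, umbral t s p := by
  obtain ⟨c, rfl⟩ := shiftedPoly_surjective p
  rw [← shiftedPoly_mapDomain_right]
  simp only [umbral_shiftedPoly]
  refine (LinearMap.congr_fun (f := binomialEval t u ∘ₗ Finsupp.lmapDomain ℚ ℚ _)
    (g := ∑ s ∈ Finset.range u, binomialEval t s) (Finsupp.lhom_ext fun ij a => ?_) c).trans ?_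
  · simp [binomialEval, Finsupp.mapDomain_single, ← Finset.mul_sum, ← Finset.sum_mul,
      sum_range_choose_eq]
  · simp

/-- The umbral form of the Chu–Vandermonde identity. -/
theorem umbral_mul_pow (t u i j a b : ℕ) :
    umbral t u ((X 0 - 1) ^ i * (X 1 - 1) ^ j * X 0 ^ a * X 1 ^ b) =
      ((t + a).choose (i + a) : ℚ) * (u + b).choose (j + b) := by
  induction a generalizing i with
  | succ a ih =>
    -- Writing x = 1 + (x − 1) makes the induction step Pascal's rule.
    have h : ((X 0 - 1) ^ i * (X 1 - 1) ^ j * X 0 ^ (a + 1) * X 1 ^ b : MvPolynomial (Fin 2) ℚ) =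
        (X 0 - 1) ^ i * (X 1 - 1) ^ j * X 0 ^ a * X 1 ^ b +
          (X 0 - 1) ^ (i + 1) * (X 1 - 1) ^ j * X 0 ^ a * X 1 ^ b := by ring
    rw [h, map_add, ih, ih, ← add_assoc, ← add_assoc, Nat.choose_succ_succ,
      show i + 1 + a = i + a + 1 by ring]
    push_cast
    ring
  | zero =>
    induction b generalizing j with
    | zero => simp [umbral_apply, mul_comm]
    | succ b ih =>
      have h : ((X 0 - 1) ^ i * (X 1 - 1) ^ j * X 0 ^ 0 * X 1 ^ (b + 1) :
          MvPolynomial (Fin 2) ℚ) = (X 0 - 1) ^ i * (X 1 - 1) ^ j * X 0 ^ 0 * X 1 ^ b +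
            (X 0 - 1) ^ i * (X 1 - 1) ^ (j + 1) * X 0 ^ 0 * X 1 ^ b := by ring
      rw [h, map_add, ih, ih, ← add_assoc, ← add_assoc, Nat.choose_succ_succ (u + b),
        show j + 1 + b = j + b + 1 by ring]
      push_cast
      ring

/-- Triangularity: at (i, j) only indices (i', j') ≤ (i, j) contribute, and the diagonal entry is 1.
-/
theorem eq_zero_of_binomialEval_eq_zero {c : ℕ × ℕ →₀ ℚ} (h : ∀ t u, binomialEval t u c = 0) :
    c = 0 := by
  have key : ∀ n i j, i + j = n → c (i, j) = 0 := by
    intro n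
    induction n using Nat.strong_induction_on with
    | _ n ih =>
      rintro i j rfl
      have h0 := h i j
      rw [binomialEval, Finsupp.linearCombination_apply, Finsupp.sum,
        Finset.sum_eq_single (i, j)] at h0
      · simpa using h0
      · rintro ⟨i', j'⟩ - hne
        rcases lt_or_ge i i' with hi | hi
        · simp [Nat.choose_eq_zero_of_lt hi]
        rcases lt_or_ge j j' with hj | hj
        · simp [Nat.choose_eq_zero_of_lt hj]
        have : i' + j' < i + j := by
          by_contra hlt
          exact hne (Prod.ext (by simp; omega) (by simp; omega))
        simp [ih _ this i' j' rfl]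
      · intro hns
        simp [Finsupp.notMem_support_iff.1 hns]
  ext ⟨i, j⟩
  exact key _ i j rfl

variable {E : Type*} [Fintype E] {r : Finset E → ℕ}

theorem isBinomialExpansion_iff {c : ℕ × ℕ →₀ ℚ} :
    IsBinomialExpansion r c ↔ ∀ t u, (latticeCount r t u : ℚ) = binomialEval t u c := by
  simp only [IsBinomialExpansion, binomialEval, Finsupp.linearCombination_apply, smul_eq_mul,
    mul_assoc]

theorem IsBinomialExpansion.unique {c d : ℕ × ℕ →₀ ℚ} (hc : IsBinomialExpansion r c)
    (hd : IsBinomialExpansion r d) : c = d := by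
  rw [isBinomialExpansion_iff] at hc hd
  refine sub_eq_zero.1 (eq_zero_of_binomialEval_eq_zero fun t u => ?_)
  rw [map_sub, ← hc, ← hd, sub_self]

theorem IsBinomialExpansion.qPrime_eq {c : ℕ × ℕ →₀ ℚ} (hc : IsBinomialExpansion r c) :
    qPrime r = shiftedPoly c := by
  have hex : ∃ c, IsBinomialExpansion r c := ⟨c, hc⟩
  have : binomialCoeffs r = c := by
    rw [binomialCoeffs, dif_pos hex]
    exact hex.choose_spec.unique hc
  simp only [qPrime, this, shiftedPoly, Finsupp.linearCombination_apply, smul_eq_C_mul, mul_assoc]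

/-! ### Divisibility by x + y − 1 and the Tutte polynomial -/

variable [DecidableEq E]

/-- The summand of `x^(|E|-r(E)) y^(r(E)) T((x+y-1)/y, (x+y-1)/x)` for the set `S`, with
denominators cleared. -/
def tutteTerm {R : Type*} [CommRing R] (r : Finset E → ℕ) (x y : R) (S : Finset E) : R :=
  (x - 1) ^ (r Finset.univ - r S) * (y - 1) ^ (S.card - r S) *
    x ^ (Sᶜ.card - (r Finset.univ - r S)) * y ^ r S

/-- Here x − 1 = −y and y − 1 = −x, so all terms are one monomial up to the sign (−1)^|S|, and these
signs cancel over the subsets of a nonempty set. -/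
theorem sum_tutteTerm_eq_zero [Nonempty E] (hr : HasAdaptedBases r) {R : Type*} [CommRing R]
    {x y : R} (h : x + y = 1) : ∑ S, tutteTerm r x y S = 0 := by
  have hterm : ∀ S : Finset E, tutteTerm r x y S =
      (-1) ^ r Finset.univ * y ^ r Finset.univ * x ^ (Fintype.card E - r Finset.univ) *
        (((-1) ^ S.card : ℤ) : R) := by
    intro S
    have h₁ := hr.le_univ S
    have h₂ := hr.univ_sub_le S
    have h₃ := hr.le_card S
    have h₄ := Finset.card_add_card_compl S
    obtain ⟨a, ha⟩ := Nat.exists_eq_add_of_le h₁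
    obtain ⟨b, hb⟩ := Nat.exists_eq_add_of_le h₃
    obtain ⟨d, hd⟩ := Nat.exists_eq_add_of_le h₂
    have e₁ : r Finset.univ - r S = a := by omega
    have e₂ : S.card - r S = b := by omega
    have e₃ : Sᶜ.card - a = d := by omega
    have e₄ : Fintype.card E - r Finset.univ = b + d := by omega
    have hx : x - 1 = -1 * y := by linear_combination h
    have hy : y - 1 = -1 * x := by linear_combination h
    have hs : ((-1 : R) ^ r S) * (-1) ^ r S = 1 := by
      rw [← mul_pow]
      simp
    rw [tutteTerm, e₁, e₂, e₃, e₄, ha, hb, hx, hy]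
    push_cast
    simp only [mul_pow, pow_add]
    linear_combination (-(-1) ^ a * y ^ a * (-1) ^ b * x ^ b * x ^ d * y ^ r S) * hs
  have hsum : ∑ S : Finset E, (-1 : ℤ) ^ S.card = 0 := by
    rw [← Finset.powerset_univ]
    exact Finset.sum_powerset_neg_one_pow_card_of_nonempty Finset.univ_nonempty
  rw [Finset.sum_congr rfl fun S _ => hterm S, ← Finset.mul_sum, ← Int.cast_sum, hsum]
  simp

/-- The vanishing on x + y = 1, applied in the quotient ring modulo x + y − 1. -/
theorem exists_mul_eq_sum_tutteTerm [Nonempty E] (hr : HasAdaptedBases r) :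
    ∃ G : MvPolynomial (Fin 2) ℚ, ∑ S, tutteTerm r (X 0) (X 1) S = (X 0 + X 1 - 1) * G := by
  let q : MvPolynomial (Fin 2) ℚ := X 0 + X 1 - 1
  let π := Ideal.Quotient.mk (Ideal.span {q})
  have hπ : π (X 0) + π (X 1) = 1 := by
    have : π q = 0 := Ideal.Quotient.eq_zero_iff_mem.2 (Ideal.mem_span_singleton_self q)
    change π (X 0 + X 1 - 1) = 0 at this
    rwa [map_sub, map_add, map_one, sub_eq_zero] at this
  have h : π (∑ S, tutteTerm r (X 0) (X 1) S) = 0 := by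
    rw [← sum_tutteTerm_eq_zero hr hπ, map_sum]
    simp [tutteTerm]
  exact Ideal.mem_span_singleton.1 (Ideal.Quotient.eq_zero_iff_mem.1 h)

theorem umbral_sum_tutteTerm (hr : HasAdaptedBases r) (t u : ℕ) :
    umbral t u (∑ S, tutteTerm r (X 0) (X 1) S) = (region r t u).ncard := by
  rw [ncard_region hr, map_sum, Nat.cast_sum]
  refine Finset.sum_congr rfl fun S _ => ?_
  have h₂ := hr.univ_sub_le S
  have h₃ := hr.le_card S
  rw [tutteTerm, umbral_mul_pow, Nat.cast_mul, Nat.add_sub_cancel' h₂, Nat.sub_add_cancel h₃]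

/-- Both sides satisfy the same recursion, which expresses the value at (t, u) by those with smaller
t + u. -/
theorem umbral_eq_latticeCount [Nonempty E] (hr : HasAdaptedBases r)
    {G : MvPolynomial (Fin 2) ℚ}
    (hG : ∑ S, tutteTerm r (X 0) (X 1) S = (X 0 + X 1 - 1) * G) (t u : ℕ) :
    (latticeCount r t u : ℚ) = umbral t u G := by
  have key : ∀ n t u, t + u = n → (latticeCount r t u : ℚ) = umbral t u G := by
    intro n
    induction n using Nat.strong_induction_on with
    | _ n ih =>
      rintro t u rfl
      have h₁ := umbral_sum_tutteTerm hr t u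
      rw [hG, show (X 0 + X 1 - 1) * G = (X 0 - 1) * G + (X 1 - 1) * G + G by ring, map_add,
        map_add, umbral_sub_one_mul_left, umbral_sub_one_mul_right, ← sum_ncard_slice hr] at h₁
      simp only [← latticeCount_eq_ncard_slice hr] at h₁
      push_cast at h₁
      rw [Finset.sum_congr (s₁ := Finset.range t) rfl fun s hs =>
          ih (s + u) (by have := Finset.mem_range.1 hs; omega) s u rfl,
        Finset.sum_congr (s₁ := Finset.range u) rfl fun s hs =>
          ih (t + s) (by have := Finset.mem_range.1 hs; omega) t s rfl] at h₁
      linarith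
  exact key _ t u rfl

theorem mul_aeval_tuttePolynomial (hr : HasAdaptedBases r) {K : Type*} [Field K] [Algebra ℚ K]
    {x y : K} (hx : x ≠ 0) (hy : y ≠ 0) :
    x ^ (Fintype.card E - r Finset.univ) * y ^ r Finset.univ *
        aeval ![(x + y - 1) / y, (x + y - 1) / x] (tuttePolynomial r) =
      ∑ S, tutteTerm r x y S := by
  rw [tuttePolynomial, map_sum, Finset.mul_sum]
  refine Finset.sum_congr rfl fun S _ => ?_
  have h₁ := hr.le_univ S
  have h₂ := hr.univ_sub_le S
  have h₃ := hr.le_card S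
  have h₄ := Finset.card_add_card_compl S
  have hX : (x + y - 1) / y - 1 = (x - 1) / y := by field_simp; ring
  have hY : (x + y - 1) / x - 1 = (y - 1) / x := by field_simp; ring
  have hxp : x ^ (Fintype.card E - r Finset.univ) =
      x ^ (S.card - r S) * x ^ (Sᶜ.card - (r Finset.univ - r S)) := by
    rw [← pow_add]; congr 1; omega
  have hyp : y ^ r Finset.univ = y ^ (r Finset.univ - r S) * y ^ r S := by
    rw [← pow_add]; congr 1; omega
  simp only [map_mul, map_pow, map_sub, map_one, aeval_X, Matrix.cons_val_zero,
    Matrix.cons_val_one, hX, hY, div_pow, tutteTerm, hxp, hyp]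
  field_simp

end RankFunction

theorem theorem3p2 {α : Type*} (M : Matroid α) [Fintype M.E] [Nonempty M.E] :
    (∃! c : ℕ × ℕ →₀ ℚ, RankFunction.IsBinomialExpansion M.rankFun c) ∧
    algebraMap (MvPolynomial (Fin 2) ℚ) RatFun2 (RankFunction.qPrime M.rankFun) =
      RatFun2.x ^ (Fintype.card M.E - M.rankFun Finset.univ) *
          RatFun2.y ^ M.rankFun Finset.univ / (RatFun2.x + RatFun2.y - 1) *
        MvPolynomial.aeval
          ![(RatFun2.x + RatFun2.y - 1) / RatFun2.y, (RatFun2.x + RatFun2.y - 1) / RatFun2.x]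
          (RankFunction.tuttePolynomial M.rankFun) := by
  classical
  have hr := M.rankFun_hasAdaptedBases
  obtain ⟨G, hG⟩ := RankFunction.exists_mul_eq_sum_tutteTerm hr
  obtain ⟨c, hc⟩ := RankFunction.shiftedPoly_surjective G
  have hexp : RankFunction.IsBinomialExpansion M.rankFun c := by
    refine RankFunction.isBinomialExpansion_iff.2 fun t u => ?_
    rw [RankFunction.umbral_eq_latticeCount hr hG, ← hc, RankFunction.umbral_shiftedPoly]
  refine ⟨⟨c, hexp, fun d hd => hd.unique hexp⟩, ?_⟩
  have hinj : Function.Injective (algebraMap (MvPolynomial (Fin 2) ℚ) RatFun2) :=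
    IsFractionRing.injective _ _
  have hx : RatFun2.x ≠ 0 := (map_ne_zero_iff _ hinj).2 (MvPolynomial.X_ne_zero 0)
  have hy : RatFun2.y ≠ 0 := (map_ne_zero_iff _ hinj).2 (MvPolynomial.X_ne_zero 1)
  have hmap : algebraMap (MvPolynomial (Fin 2) ℚ) RatFun2 (MvPolynomial.X 0 + MvPolynomial.X 1 - 1) =
      RatFun2.x + RatFun2.y - 1 := by
    simp [RatFun2.x, RatFun2.y]
  have hxy : RatFun2.x + RatFun2.y - 1 ≠ 0 := by
    rw [← hmap, map_ne_zero_iff _ hinj]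
    intro h
    simpa using congrArg (MvPolynomial.eval 0) h
  have hG' := congrArg (algebraMap (MvPolynomial (Fin 2) ℚ) RatFun2) hG
  rw [map_mul, hmap, map_sum] at hG'
  have hterm : ∀ S, algebraMap (MvPolynomial (Fin 2) ℚ) RatFun2
      (RankFunction.tutteTerm M.rankFun (MvPolynomial.X 0) (MvPolynomial.X 1) S) =
      RankFunction.tutteTerm M.rankFun RatFun2.x RatFun2.y S := fun S => by
    simp [RankFunction.tutteTerm, RatFun2.x, RatFun2.y]
  rw [Finset.sum_congr rfl fun S _ => hterm S,
    ← RankFunction.mul_aeval_tuttePolynomial hr hx hy] at hG'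
  rw [hexp.qPrime_eq, hc, div_mul_eq_mul_div, hG', mul_div_cancel_left₀ _ hxy]
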